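/- **Setting.** Let $n\ge 1$, $k\ge 0$. For $a=(a_{x,i},a_{z,i})_{i\le n}\in\mathbb Z_2^{2n}$ let $P_a=\bigotimes_{i=1}^n \mathrm i^{a_{x,i}a_{z,i}}X^{a_{x,i}}Z^{a_{z,i}}$ be the corresponding $n$-qubit Pauli operator and $\langle a,b\rangle=\sum_i(a_{x,i}b_{z,i}+a_{z,i}b_{x,i})\bmod 2$. A Pauli channel is a map $\Lambda(\rho)=\sum_a p_aP_a\rho P_a$ with $(p_a)_a$ a probability vector; its Pauli eigenvalues are $\lambda_b=\sum_a p_a(-1)^{\langle a,b\rangle}$. *Protocols.* An adaptive concatenating protocol with $k$ ancilla qubits consists of finitely many rounds. In a round it prepares a state $\rho$ of the $n$ working and $k$ ancilla qubits, alternately applies the unknown channel $\Lambda\otimes\mathrm{id}$ (acting on the working qubits) and quantum channels $\mathcal C_1,\dots,\mathcal C_m$ of its choice on all $n+k$ qubits, i.e. it produces $\mathcal C_m(\Lambda\otimes\mathrm{id}(\cdots\mathcal C_1(\Lambda\otimes\mathrm{id}(\rho))\cdots))$ with $m\ge 0$ queries, and then measures a finite-outcome POVM on all $n+k$ qubits.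 Whether there is a further round, and the state, the number $m$ of queries, the channels and the POVM of that round, may depend on all earlier outcomes. At the end the protocol outputs an answer that is a function of all outcomes. Its number of queries is the maximum, over all sequences of outcomes, of the total number of uses of $\Lambda$. *Tasks.* - The protocol solves *Pauli eigenvalue estimation* to error $\varepsilon$ with probability at least $\delta$ if for every Pauli channel, with probability at least $\delta$, it outputs estimates $(\hat\lambda_b)_b$ with $\max_b|\hat\lambda_b-\lambda_b|<\varepsilon$. - It solves *Pauli spike detection* with probability at least $\delta$ if it decides correctly, with probability at least $\delta$, which of the following two equally likely cases holds: the unknown channel is $\Lambda_{\mathrm{dep}}(\rho)=2^{-n}\operatorname{Tr}(\rho)\,I$; or it is $\Lambda_a(\rho)=2^{-n}\big(\operatorname{Tr}(\rho)\,I+\operatorname{Tr}(P_a\rho)\,P_a\big)$ with $a$ uniformly random in $\mathbb Z_2^{2n}\setminus\{0\}$. **Theorem.** For every $\delta>1/2$ there is a constant $c>0$, depending only on $\delta$, such that for all $n\ge 1$ and $k\ge 0$: 1. for every $0<\varepsilon\le 1$, every (possibly adaptive and concatenating) protocol with $k$ ancilla qubits that solves Pauli eigenvalue estimation to error $\varepsilon$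 with probability at least $\delta$ makes at least $c\,2^{(n-k)/3}$ queries to the unknown channel; 2. every such protocol that solves Pauli spike detection with probability at least $\delta$ makes at least $c\,2^{(n-k)/3}$ queries to the unknown channel. -/

import Mathlib

noncomputable section

namespace PauliLearning

open scoped Matrix ComplexOrder

/-! ### Finite-dimensional quantum mechanics -/

/-- Computational basis labels of `n` qubits. -/
abbrev Qubits (n : ℕ) : Type := Fin n → Fin 2

/-- Basis labels of `n` working qubits together with `k` ancilla qubits. -/
abbrev Sys (n k : ℕ) : Type := Qubits n × Qubits k

/-- Density matrices on the Hilbert space with orthonormal basis `I`. -/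
structure DensityMatrix (I : Type) [Fintype I] where
  mat : Matrix I I ℂ
  posSemidef : mat.PosSemidef
  trace_eq_one : mat.trace = 1

/-- `ampliate A Φ` is the map `Φ ⊗ id` on matrices over `I × A`: it applies `Φ` to every block of
the matrix that is obtained by fixing the two `A`-indices. -/
def ampliate {I : Type} (A : Type) (Φ : Matrix I I ℂ →ₗ[ℂ] Matrix I I ℂ) :
    Matrix (I × A) (I × A) ℂ →ₗ[ℂ] Matrix (I × A) (I × A) ℂ where
  toFun X := Matrix.of fun s t =>
    Φ (Matrix.of fun i j => X (i, s.2) (j, t.2)) s.1 t.1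
  map_add' X Y := by
    ext s t
    have h : (Matrix.of fun i j => (X + Y) (i, s.2) (j, t.2)) =
        (Matrix.of fun i j => X (i, s.2) (j, t.2)) +
          (Matrix.of fun i j => Y (i, s.2) (j, t.2)) := by
      ext i j; simp
    rw [Matrix.of_apply, h, map_add]
    rfl
  map_smul' c X := by
    ext s t
    have h : (Matrix.of fun i j => (c • X) (i, s.2) (j, t.2)) =
        c • (Matrix.of fun i j => X (i, s.2) (j, t.2)) := by
      ext i j; simp
    rw [Matrix.of_apply, h, map_smul]
    rfl

/-- Quantum channels on the space with basis `I`: completely positive trace-preserving maps. -/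
structure QuantumChannel (I : Type) [Fintype I] where
  map : Matrix I I ℂ →ₗ[ℂ] Matrix I I ℂ
  completelyPositive : ∀ (d : ℕ) (X : Matrix (I × Fin d) (I × Fin d) ℂ),
    X.PosSemidef → (ampliate (Fin d) map X).PosSemidef
  tracePreserving : ∀ X : Matrix I I ℂ, (map X).trace = X.trace

/-- POVMs with outcomes `0, …, r - 1`. -/
structure POVM (I : Type) [Fintype I] [DecidableEq I] (r : ℕ) where
  effect : Fin r → Matrix I I ℂ
  posSemidef : ∀ j, (effect j).PosSemidef
  sum_eq_one : ∑ j, effect j = 1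

/-! ### Pauli operators and Pauli channels -/

/-- `ℤ₂²ⁿ`: the entry `a i = (x, z)` holds the two bits of `a` at qubit `i`. -/
abbrev PauliIndex (n : ℕ) : Type := Fin n → ZMod 2 × ZMod 2

/-- The single-qubit operator `i ^ (x z) X ^ x Z ^ z`. -/
def pauli₁ (a : ZMod 2 × ZMod 2) : Matrix (Fin 2) (Fin 2) ℂ :=
  Complex.I ^ (a.1.val * a.2.val) •
    ((!![0, 1; 1, 0] : Matrix (Fin 2) (Fin 2) ℂ) ^ a.1.val *
      (!![1, 0; 0, -1] : Matrix (Fin 2) (Fin 2) ℂ) ^ a.2.val)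

/-- The `n`-qubit Pauli operator `P_a`, the tensor product of the `pauli₁ (a i)`. -/
def pauli {n : ℕ} (a : PauliIndex n) : Matrix (Qubits n) (Qubits n) ℂ :=
  Matrix.of fun s t => ∏ i, pauli₁ (a i) (s i) (t i)

/-- The symplectic form `⟨a, b⟩` on `ℤ₂²ⁿ`. -/
def symplectic {n : ℕ} (a b : PauliIndex n) : ZMod 2 :=
  ∑ i, ((a i).1 * (b i).2 + (a i).2 * (b i).1)

/-- The Pauli channel `ρ ↦ ∑ₐ pₐ Pₐ ρ Pₐ` with error rates `p`. -/
def pauliChannel {n : ℕ} (p : PauliIndex n → ℝ) :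
    Matrix (Qubits n) (Qubits n) ℂ →ₗ[ℂ] Matrix (Qubits n) (Qubits n) ℂ :=
  ∑ a, (p a : ℂ) • (LinearMap.mulRight ℂ (pauli a) ∘ₗ LinearMap.mulLeft ℂ (pauli a))

/-- The Pauli eigenvalues `λ_b = ∑ₐ pₐ (-1) ^ ⟨a, b⟩` of the Pauli channel with error rates `p`. -/
def pauliEigenvalue {n : ℕ} (p : PauliIndex n → ℝ) (b : PauliIndex n) : ℝ :=
  ∑ a, p a * (-1) ^ (symplectic a b).val

/-- The completely depolarizing channel `ρ ↦ 2⁻ⁿ Tr(ρ) I`. -/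
def depolarizing (n : ℕ) :
    Matrix (Qubits n) (Qubits n) ℂ →ₗ[ℂ] Matrix (Qubits n) (Qubits n) ℂ :=
  ((2 : ℂ) ^ n)⁻¹ • (Matrix.traceLinearMap (Qubits n) ℂ ℂ).smulRight 1

/-- The spiked channel `ρ ↦ 2⁻ⁿ (Tr(ρ) I + Tr(Pₐ ρ) Pₐ)`. -/
def spiked {n : ℕ} (a : PauliIndex n) :
    Matrix (Qubits n) (Qubits n) ℂ →ₗ[ℂ] Matrix (Qubits n) (Qubits n) ℂ :=
  ((2 : ℂ) ^ n)⁻¹ • ((Matrix.traceLinearMap (Qubits n) ℂ ℂ).smulRight 1 +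
    (Matrix.traceLinearMap (Qubits n) ℂ ℂ ∘ₗ LinearMap.mulLeft ℂ (pauli a)).smulRight (pauli a))

/-! ### Adaptive concatenating protocols with `k` ancilla qubits -/

/-- Adaptive, concatenating protocols on `n` working qubits and `k` ancilla qubits, with answers
in `O`, as finite trees. A node either stops with an answer, or performs a round: it prepares a
state of all `n + k` qubits, queries the unknown channel once for each entry of the list of
data-processing channels, applying that entry right after the query, and measures a POVM on all
`n + k` qubits; the rest of the protocol depends on the outcome, hence (inductively) on the whole
history of outcomes. The last entry of a list may be the identity, so the round may also end in a
query; a round with the empty list makes no query and is a source of classical randomness. -/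
inductive Protocol (n k : ℕ) (O : Type) : Type
  | output (o : O) : Protocol n k O
  | round (ρ : DensityMatrix (Sys n k)) (channels : List (QuantumChannel (Sys n k))) (r : ℕ)
      (M : POVM (Sys n k) r) (next : Fin r → Protocol n k O) : Protocol n k O

/-- The state before the measurement of a round: `C_m (Λ ⊗ id (⋯ C₁ (Λ ⊗ id (ρ))))`. -/
def evolve {n k : ℕ} (Λ : Matrix (Qubits n) (Qubits n) ℂ →ₗ[ℂ] Matrix (Qubits n) (Qubits n) ℂ)
    (ρ : DensityMatrix (Sys n k)) (channels : List (QuantumChannel (Sys n k))) :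
    Matrix (Sys n k) (Sys n k) ℂ :=
  channels.foldl (fun σ C => C.map (ampliate (Qubits k) Λ σ)) ρ.mat

namespace Protocol

variable {n k : ℕ} {O : Type}

/-- The probability that the answer of the protocol lies in `S` when the unknown channel is `Λ`;
outcome `j` of a round has probability `Tr (E_j ρ_out)`. -/
def prob (Λ : Matrix (Qubits n) (Qubits n) ℂ →ₗ[ℂ] Matrix (Qubits n) (Qubits n) ℂ) (S : Set O) :
    Protocol n k O → ℝ
  | output o => S.indicator 1 o
  | round ρ channels _ M next =>
      ∑ j, (M.effect j * evolve Λ ρ channels).trace.re * prob Λ S (next j)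

/-- The query complexity: the largest total number of queries to the unknown channel along a
branch of the protocol. -/
def queries : Protocol n k O → ℕ
  | output _ => 0
  | round _ channels _ _ next => channels.length + Finset.univ.sup fun j => queries (next j)

end Protocol

/-- The protocol solves Pauli eigenvalue estimation to error `ε` with probability at least `δ`:
for every Pauli channel, with that probability all its estimates are off by less than `ε`. -/
def SolvesEigenvalueEstimation {n k : ℕ} (𝒜 : Protocol n k (PauliIndex n → ℝ)) (ε δ : ℝ) : Prop :=
  ∀ p ∈ stdSimplex ℝ (PauliIndex n),
    δ ≤ 𝒜.prob (pauliChannel p) {est | ∀ b, |est b - pauliEigenvalue p b| < ε}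

/-- The protocol solves Pauli spike detection with probability at least `δ`: the unknown channel is
with equal probability either depolarizing (correct answer `false`) or spiked at a uniformly
random `a ≠ 0` (correct answer `true`). -/
def SolvesSpikeDetection {n k : ℕ} (𝒜 : Protocol n k Bool) (δ : ℝ) : Prop :=
  δ ≤ 1 / 2 * 𝒜.prob (depolarizing n) {false} +
    1 / 2 * ((∑ a : {a : PauliIndex n // a ≠ 0}, 𝒜.prob (spiked a.1) {true}) / (4 ^ n - 1))

end PauliLearning

end

open PauliLearning

/-! A single use of a spiked channel `Λ_a` on a state of `n + k` qubits differs from a use of the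
depolarizing channel, on each ancilla block `X` of the state, by a multiple of `Tr(P_a X) P_a`.
Parseval's identity for the Pauli basis bounds the squared Hilbert-Schmidt norms of these
differences, summed over `a`, by the purity of the state, hence by `1`. Cauchy-Schwarz, from the
trace norm to the Hilbert-Schmidt norm and then over `a ≠ 0`, bounds the sum of their trace norms
by `√((4 ^ n - 1) 2 ^ (n + k))`. Replacing the spiked by the depolarizing channel one query at a
time, the total change in the outcome probabilities is at most this number times the number of
queries, whereas success requires a total change of order `(2 δ - 1) (4 ^ n - 1)`. This gives
`2 ^ ((n - k) / 2)` queries up to a constant. Estimation to error at most `1` tells, for each `a`,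
the eigenvalue `1` at `a` from the eigenvalue `-1`, so it is subject to the same bound. -/

namespace PauliLearning

open scoped Matrix ComplexOrder

/-! ### Trace norm and Hilbert-Schmidt norm -/

section PosSemidef

open scoped MatrixOrder

variable {I : Type*} [Fintype I] {X Y : Matrix I I ℂ}

lemma trace_mul_re_nonneg (hX : X.PosSemidef) (hY : Y.PosSemidef) : 0 ≤ (X * Y).trace.re := by
  classical
  obtain ⟨B, rfl⟩ := CStarAlgebra.nonneg_iff_eq_star_mul_self.1 hX.nonneg
  rw [Matrix.star_eq_conjTranspose, Matrix.mul_assoc, Matrix.trace_mul_comm]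
  exact (Complex.le_def.1 (hY.mul_mul_conjTranspose_same B).trace_nonneg).1

lemma exists_posSemidef_sub_eq (hX : X.IsHermitian) :
    ∃ P Q : Matrix I I ℂ, P.PosSemidef ∧ Q.PosSemidef ∧ X = P - Q ∧ P * Q = 0 ∧ Q * P = 0 := by
  classical
  exact ⟨X⁺, X⁻, Matrix.nonneg_iff_posSemidef.1 (CFC.posPart_nonneg X),
    Matrix.nonneg_iff_posSemidef.1 (CFC.negPart_nonneg X),
    (CFC.posPart_sub_negPart X hX.isSelfAdjoint).symm, CFC.posPart_mul_negPart X,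
    CFC.negPart_mul_posPart X⟩

end PosSemidef

section Frobenius

open scoped Matrix.Norms.Frobenius

variable {I J : Type*} [Fintype I] [Fintype J]

lemma frobenius_norm_sq (X : Matrix I J ℂ) : ‖X‖ ^ 2 = ∑ i, ∑ j, ‖X i j‖ ^ 2 := by
  rw [Matrix.frobenius_norm_def, ← Real.sqrt_eq_rpow, Real.sq_sqrt (by positivity)]
  simp only [Real.rpow_two]

lemma frobenius_norm_sq_eq_trace (X : Matrix I J ℂ) : (‖X‖ ^ 2 : ℂ) = (Xᴴ * X).trace := by
  rw [← Complex.ofReal_pow, frobenius_norm_sq, Finset.sum_comm]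
  simp [Matrix.trace, Matrix.mul_apply, Complex.conj_mul']

lemma frobenius_norm_sq_eq_sum_submatrix (X : Matrix (I × J) (I × J) ℂ) :
    ‖X‖ ^ 2 = ∑ u, ∑ v, ‖X.submatrix (·, u) (·, v)‖ ^ 2 := by
  simp only [frobenius_norm_sq, Fintype.sum_prod_type_right, Matrix.submatrix_apply]
  exact Finset.sum_congr rfl fun u _ => Finset.sum_comm

lemma norm_trace_le (X : Matrix I I ℂ) : ‖X.trace‖ ≤ √(Fintype.card I) * ‖X‖ := by
  refine abs_le_of_sq_le_sq' ?_ (by positivity) |>.2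
  calc ‖X.trace‖ ^ 2 ≤ (∑ i, ‖X i i‖) ^ 2 := by gcongr; exact norm_sum_le _ _
    _ ≤ Fintype.card I * ∑ i, ‖X i i‖ ^ 2 := sq_sum_le_card_mul_sum_sq
    _ ≤ Fintype.card I * ∑ i, ∑ j, ‖X i j‖ ^ 2 := by
        gcongr with i
        exact Finset.single_le_sum (f := fun j => ‖X i j‖ ^ 2) (fun j _ => sq_nonneg _)
          (Finset.mem_univ i)
    _ = (√(Fintype.card I) * ‖X‖) ^ 2 := by
        rw [mul_pow, Real.sq_sqrt (Nat.cast_nonneg _), frobenius_norm_sq]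

lemma frobenius_norm_le_trace {X : Matrix I I ℂ} (hX : X.PosSemidef) : ‖X‖ ≤ X.trace.re := by
  classical
  open scoped MatrixOrder in
  obtain ⟨B, rfl⟩ := CStarAlgebra.nonneg_iff_eq_star_mul_self.1 hX.nonneg
  calc ‖Bᴴ * B‖ ≤ ‖Bᴴ‖ * ‖B‖ := Matrix.frobenius_norm_mul _ _
    _ = ‖B‖ ^ 2 := by rw [Matrix.frobenius_norm_conjTranspose, sq]
    _ = (Bᴴ * B).trace.re := by
        rw [← frobenius_norm_sq_eq_trace, ← Complex.ofReal_pow, Complex.ofReal_re]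

end Frobenius

section TraceNorm

open scoped Matrix.Norms.Frobenius

variable {I : Type*} [Fintype I] {X Y : Matrix I I ℂ} {σ τ : ℝ}

/-- The trace norm of the Hermitian matrix `X` is at most `τ`. It is encoded by a decomposition
into positive parts, which positive maps visibly preserve. -/
def TraceNormLE (X : Matrix I I ℂ) (τ : ℝ) : Prop :=
  ∃ P Q : Matrix I I ℂ, P.PosSemidef ∧ Q.PosSemidef ∧ X = P - Q ∧ (P + Q).trace.re ≤ τ

/-- Positive trace-preserving maps on matrices. -/
structure IsPositiveTP (Φ : Matrix I I ℂ →ₗ[ℂ] Matrix I I ℂ) : Prop where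
  posSemidef : ∀ X, X.PosSemidef → (Φ X).PosSemidef
  trace_map : ∀ X, (Φ X).trace = X.trace

lemma traceNormLE_zero : TraceNormLE (0 : Matrix I I ℂ) 0 :=
  ⟨0, 0, .zero, .zero, by simp, by simp⟩

lemma TraceNormLE.add (hX : TraceNormLE X σ) (hY : TraceNormLE Y τ) :
    TraceNormLE (X + Y) (σ + τ) := by
  obtain ⟨P, Q, hP, hQ, rfl, hσ⟩ := hX
  obtain ⟨P', Q', hP', hQ', rfl, hτ⟩ := hY
  refine ⟨P + P', Q + Q', hP.add hP', hQ.add hQ', by abel, ?_⟩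
  rw [add_add_add_comm, Matrix.trace_add, Complex.add_re]
  exact add_le_add hσ hτ

lemma TraceNormLE.map (hX : TraceNormLE X τ) {Φ : Matrix I I ℂ →ₗ[ℂ] Matrix I I ℂ}
    (hΦ : IsPositiveTP Φ) : TraceNormLE (Φ X) τ := by
  obtain ⟨P, Q, hP, hQ, rfl, hτ⟩ := hX
  exact ⟨Φ P, Φ Q, hΦ.posSemidef _ hP, hΦ.posSemidef _ hQ, map_sub _ _ _, by
    rwa [← map_add, hΦ.trace_map]⟩

lemma TraceNormLE.abs_trace_mul_le [DecidableEq I] (hX : TraceNormLE X τ) {E : Matrix I I ℂ}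
    (hE : E.PosSemidef) (hE' : (1 - E).PosSemidef) : |(E * X).trace.re| ≤ τ := by
  obtain ⟨P, Q, hP, hQ, rfl, hτ⟩ := hX
  have hEP := trace_mul_re_nonneg hE hP
  have hEQ := trace_mul_re_nonneg hE hQ
  have hEP' := trace_mul_re_nonneg hE' hP
  have hEQ' := trace_mul_re_nonneg hE' hQ
  simp only [Matrix.sub_mul, Matrix.mul_sub, one_mul, Matrix.trace_sub, Matrix.trace_add,
    Complex.sub_re, Complex.add_re] at *
  rw [abs_le]
  constructor <;> linarith

lemma traceNormLE_of_isHermitian (hX : X.IsHermitian) :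
    TraceNormLE X (√(Fintype.card I) * ‖X‖) := by
  obtain ⟨P, Q, hP, hQ, rfl, hPQ, hQP⟩ := exists_posSemidef_sub_eq hX
  have hsq : (P + Q)ᴴ * (P + Q) = (P - Q)ᴴ * (P - Q) := by
    rw [(hP.add hQ).isHermitian.eq, hX.eq]
    simp only [add_mul, mul_add, sub_mul, mul_sub, hPQ, hQP]
    abel
  have hnorm : ‖P + Q‖ = ‖P - Q‖ := by
    have h := congrArg Matrix.trace hsq
    rw [← frobenius_norm_sq_eq_trace, ← frobenius_norm_sq_eq_trace] at h
    exact (sq_eq_sq₀ (norm_nonneg _) (norm_nonneg _)).1 (by exact_mod_cast h)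
  refine ⟨P, Q, hP, hQ, rfl, ?_⟩
  rw [← hnorm]
  exact (Complex.re_le_norm _).trans (norm_trace_le _)

end TraceNorm

/-! ### Tensor products and Pauli operators -/

section TensorProduct

variable {ι R : Type*} [Fintype ι] [CommSemiring R] {m : ι → Type*}

/-- The tensor product `⨂ i, A i` of a finite family of matrices. Row and column labels are
families of labels of the factors. -/
def piTensor (A : ∀ i, Matrix (m i) (m i) R) : Matrix (∀ i, m i) (∀ i, m i) R :=
  Matrix.of fun s t => ∏ i, A i (s i) (t i)

lemma piTensor_one [∀ i, DecidableEq (m i)] :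
    piTensor (fun i => (1 : Matrix (m i) (m i) R)) = 1 := by
  ext s t
  simp [piTensor, Matrix.one_apply, Finset.prod_ite_zero, funext_iff]

lemma piTensor_mul [DecidableEq ι] [∀ i, Fintype (m i)] (A B : ∀ i, Matrix (m i) (m i) R) :
    piTensor A * piTensor B = piTensor fun i => A i * B i := by
  ext s t
  simp only [piTensor, Matrix.mul_apply, Matrix.of_apply, ← Finset.prod_mul_distrib,
    Fintype.prod_sum]

lemma piTensor_smul (c : ι → R) (A : ∀ i, Matrix (m i) (m i) R) :
    (piTensor fun i => c i • A i) = (∏ i, c i) • piTensor A := by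
  ext s t
  simp [piTensor, Finset.prod_mul_distrib]

lemma conjTranspose_piTensor [StarRing R] (A : ∀ i, Matrix (m i) (m i) R) :
    (piTensor A)ᴴ = piTensor fun i => (A i)ᴴ := by
  ext s t
  simp [piTensor, star_prod]

end TensorProduct

lemma neg_one_pow_val_add {R : Type*} [Ring R] (x y : ZMod 2) :
    (-1 : R) ^ (x + y).val = (-1) ^ x.val * (-1) ^ y.val := by
  rw [ZMod.val_add, ← pow_add, neg_one_pow_eq_pow_mod_two (n := x.val + y.val)]

lemma neg_one_pow_val_sum {R ι : Type*} [CommRing R] (s : Finset ι) (f : ι → ZMod 2) :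
    (-1 : R) ^ (∑ i ∈ s, f i).val = ∏ i ∈ s, (-1) ^ (f i).val := by
  classical
  induction s using Finset.induction_on with
  | empty => simp
  | insert i s hi ih => rw [Finset.sum_insert hi, Finset.prod_insert hi, neg_one_pow_val_add, ih]

section SingleQubit

lemma forall_zmod_two_prod {p : ZMod 2 × ZMod 2 → Prop} :
    (∀ a, p a) ↔ p (0, 0) ∧ p (0, 1) ∧ p (1, 0) ∧ p (1, 1) := by
  refine ⟨fun h => ⟨h _, h _, h _, h _⟩, fun ⟨h00, h01, h10, h11⟩ a => ?_⟩
  obtain rfl | rfl | rfl | rfl : a = (0, 0) ∨ a = (0, 1) ∨ a = (1, 0) ∨ a = (1, 1) := by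
    revert a; decide
  all_goals assumption

lemma sum_zmod_two_prod {M : Type*} [AddCommMonoid M] (f : ZMod 2 × ZMod 2 → M) :
    ∑ a, f a = f (0, 0) + f (0, 1) + (f (1, 0) + f (1, 1)) := by
  rw [Fintype.sum_prod_type]
  exact (Fin.sum_univ_two _).trans (congrArg₂ _ (Fin.sum_univ_two _) (Fin.sum_univ_two _))

lemma pauli₁_zero_zero : pauli₁ (0, 0) = 1 := by
  simp [pauli₁]

lemma pauli₁_zero_one : pauli₁ (0, 1) = !![1, 0; 0, -1] := by
  simp [pauli₁, ZMod.val_one]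

lemma pauli₁_one_zero : pauli₁ (1, 0) = !![0, 1; 1, 0] := by
  simp [pauli₁, ZMod.val_one]

lemma pauli₁_one_one : pauli₁ (1, 1) = !![0, -Complex.I; Complex.I, 0] := by
  simp [pauli₁, ZMod.val_one]

lemma pauli₁_isHermitian (a : ZMod 2 × ZMod 2) : (pauli₁ a).IsHermitian := by
  revert a
  simp only [forall_zmod_two_prod, pauli₁_zero_zero, pauli₁_zero_one, pauli₁_one_zero,
    pauli₁_one_one]
  refine ⟨Matrix.isHermitian_one, ?_, ?_, ?_⟩ <;> ext i j <;> fin_cases i <;> fin_cases j <;> simp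

lemma pauli₁_mul_self (a : ZMod 2 × ZMod 2) : pauli₁ a * pauli₁ a = 1 := by
  revert a
  simp only [forall_zmod_two_prod, pauli₁_zero_zero, pauli₁_zero_one, pauli₁_one_zero,
    pauli₁_one_one]
  simp [Matrix.one_fin_two]

lemma pauli₁_mul_comm (a b : ZMod 2 × ZMod 2) :
    pauli₁ a * pauli₁ b =
      (-1 : ℂ) ^ (a.1 * b.2 + a.2 * b.1).val • (pauli₁ b * pauli₁ a) := by
  have htwo : (1 + 1 : ZMod 2) = 0 := rfl
  revert a b
  simp only [forall_zmod_two_prod, pauli₁_zero_zero, pauli₁_zero_one, pauli₁_one_zero,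
    pauli₁_one_one]
  simp [ZMod.val_one, htwo]

lemma sum_pauli₁_apply_mul_apply (s i j t : Fin 2) :
    ∑ a, pauli₁ a s i * pauli₁ a j t =
      2 * ((1 : Matrix (Fin 2) (Fin 2) ℂ) s t * (1 : Matrix (Fin 2) (Fin 2) ℂ) i j) := by
  simp only [sum_zmod_two_prod, pauli₁_zero_zero, pauli₁_zero_one, pauli₁_one_zero, pauli₁_one_one]
  fin_cases s <;> fin_cases i <;> fin_cases j <;> fin_cases t <;> norm_num

lemma sum_neg_one_pow_eq_zero {a : ZMod 2 × ZMod 2} (ha : a ≠ 0) :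
    ∑ b : ZMod 2 × ZMod 2, (-1 : ℝ) ^ (a.1 * b.2 + a.2 * b.1).val = 0 := by
  have htwo : (1 + 1 : ZMod 2) = 0 := rfl
  revert a
  simp only [forall_zmod_two_prod, sum_zmod_two_prod]
  simp [ZMod.val_one, htwo]

end SingleQubit

section Pauli

variable {n : ℕ}

lemma pauli_eq_piTensor (a : PauliIndex n) : pauli a = piTensor fun i => pauli₁ (a i) := rfl

lemma pauli_isHermitian (a : PauliIndex n) : (pauli a).IsHermitian := by
  simp only [Matrix.IsHermitian, pauli_eq_piTensor, conjTranspose_piTensor,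
    (pauli₁_isHermitian _).eq]

lemma pauli_mul_self (a : PauliIndex n) : pauli a * pauli a = 1 := by
  simp only [pauli_eq_piTensor, piTensor_mul, pauli₁_mul_self, piTensor_one]

lemma pauli_mul_comm (a b : PauliIndex n) :
    pauli a * pauli b = (-1 : ℂ) ^ (symplectic a b).val • (pauli b * pauli a) := by
  simp only [pauli_eq_piTensor, piTensor_mul, symplectic, neg_one_pow_val_sum, ← piTensor_smul,
    ← pauli₁_mul_comm]

lemma symplectic_comm (a b : PauliIndex n) : symplectic a b = symplectic b a :=
  Finset.sum_congr rfl fun i _ => by ring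

lemma sum_neg_one_pow_symplectic {a : PauliIndex n} (ha : a ≠ 0) :
    ∑ b, (-1 : ℝ) ^ (symplectic a b).val = 0 := by
  obtain ⟨l, hl⟩ := Function.ne_iff.1 ha
  simp only [symplectic, neg_one_pow_val_sum]
  rw [← Fintype.prod_sum fun i (b : ZMod 2 × ZMod 2) =>
    (-1 : ℝ) ^ ((a i).1 * b.2 + (a i).2 * b.1).val]
  exact Finset.prod_eq_zero (Finset.mem_univ l) (sum_neg_one_pow_eq_zero hl)

lemma sum_pauli_apply_mul_apply (s i j t : Qubits n) :
    ∑ a, pauli a s i * pauli a j t =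
      2 ^ n * ((1 : Matrix (Qubits n) (Qubits n) ℂ) s t *
        (1 : Matrix (Qubits n) (Qubits n) ℂ) i j) := by
  simp only [← piTensor_one, pauli_eq_piTensor, piTensor, Matrix.of_apply,
    ← Finset.prod_mul_distrib]
  rw [← Fintype.prod_sum fun l (b : ZMod 2 × ZMod 2) =>
    pauli₁ b (s l) (i l) * pauli₁ b (j l) (t l)]
  simp [sum_pauli₁_apply_mul_apply, Finset.prod_mul_distrib]

lemma sum_pauli_mul_mul_pauli (X : Matrix (Qubits n) (Qubits n) ℂ) :
    ∑ a, pauli a * X * pauli a = (2 ^ n * X.trace) • 1 := by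
  ext s t
  calc (∑ a, pauli a * X * pauli a : Matrix (Qubits n) (Qubits n) ℂ) s t
      = ∑ j, ∑ i, X i j * ∑ a, pauli a s i * pauli a j t := by
        simp only [Matrix.sum_apply, Matrix.mul_apply, Finset.mul_sum, Finset.sum_mul]
        rw [Finset.sum_comm]
        refine Finset.sum_congr rfl fun j _ => ?_
        rw [Finset.sum_comm]
        exact Finset.sum_congr rfl fun i _ => Finset.sum_congr rfl fun a _ => by ring
    _ = ((2 ^ n * X.trace) • (1 : Matrix (Qubits n) (Qubits n) ℂ)) s t := by
        simp only [sum_pauli_apply_mul_apply, Matrix.one_apply, mul_ite, mul_one, mul_zero,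
          Finset.sum_ite_eq', Finset.mem_univ, if_true, Matrix.smul_apply, smul_eq_mul,
          Matrix.trace, Matrix.diag, Finset.mul_sum]
        split_ifs <;> simp [mul_comm]

/-- Moving one `P_a` through each `P_b` absorbs the signs and leaves the full Pauli twirl of
`P_a X`. -/
lemma sum_neg_one_pow_smul_pauli_mul_mul_pauli (a : PauliIndex n)
    (X : Matrix (Qubits n) (Qubits n) ℂ) :
    ∑ b, (-1 : ℂ) ^ (symplectic a b).val • (pauli b * X * pauli b) =
      (2 ^ n * (pauli a * X).trace) • pauli a := by
  have hterm (b : PauliIndex n) : (-1 : ℂ) ^ (symplectic a b).val • (pauli b * X * pauli b) =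
      pauli a * (pauli b * (pauli a * X) * pauli b) := by
    calc (-1 : ℂ) ^ (symplectic a b).val • (pauli b * X * pauli b)
        = pauli a * pauli a * ((-1 : ℂ) ^ (symplectic a b).val • (pauli b * X * pauli b)) := by
          rw [pauli_mul_self, one_mul]
      _ = pauli a * (((-1 : ℂ) ^ (symplectic a b).val • (pauli a * pauli b)) * X * pauli b) := by
          simp only [Matrix.mul_smul, Matrix.smul_mul, mul_assoc]
      _ = pauli a * (pauli b * (pauli a * X) * pauli b) := by
          rw [symplectic_comm, ← pauli_mul_comm]
          simp only [mul_assoc]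
  rw [Finset.sum_congr rfl fun b _ => hterm b, ← Finset.mul_sum, sum_pauli_mul_mul_pauli,
    Matrix.mul_smul, mul_one]

open scoped Matrix.Norms.Frobenius

lemma frobenius_norm_sq_pauli (a : PauliIndex n) : ‖pauli a‖ ^ 2 = 2 ^ n := by
  have h := frobenius_norm_sq_eq_trace (pauli a)
  rw [(pauli_isHermitian a).eq, pauli_mul_self, Matrix.trace_one, Fintype.card_fun,
    Fintype.card_fin, Fintype.card_fin] at h
  exact_mod_cast h

lemma sum_trace_pauli_mul_smul_pauli (X : Matrix (Qubits n) (Qubits n) ℂ) :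
    ∑ a, (pauli a * X).trace • pauli a = (2 : ℂ) ^ n • X := by
  ext s t
  calc (∑ a, (pauli a * X).trace • pauli a : Matrix (Qubits n) (Qubits n) ℂ) s t
      = ∑ j, ∑ i, X i j * ∑ a, pauli a j i * pauli a s t := by
        simp only [Matrix.sum_apply, Matrix.smul_apply, Matrix.trace, Matrix.diag,
          Matrix.mul_apply, smul_eq_mul, Finset.mul_sum, Finset.sum_mul]
        rw [Finset.sum_comm]
        refine Finset.sum_congr rfl fun j _ => ?_
        rw [Finset.sum_comm]
        exact Finset.sum_congr rfl fun i _ => Finset.sum_congr rfl fun a _ => by ring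
    _ = ((2 : ℂ) ^ n • X) s t := by
        simp [sum_pauli_apply_mul_apply, Matrix.one_apply, mul_comm]

lemma sum_norm_sq_trace_pauli_mul (X : Matrix (Qubits n) (Qubits n) ℂ) :
    ∑ a, ‖(pauli a * X).trace‖ ^ 2 = 2 ^ n * ‖X‖ ^ 2 := by
  have hterm (a : PauliIndex n) : (‖(pauli a * X).trace‖ ^ 2 : ℂ) =
      (Xᴴ * (pauli a * X).trace • pauli a).trace := by
    rw [Matrix.mul_smul, Matrix.trace_smul, smul_eq_mul, ← Complex.mul_conj', ← Complex.star_def,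
      ← Matrix.trace_conjTranspose, Matrix.conjTranspose_mul, (pauli_isHermitian a).eq]
  have hsum : (∑ a, ‖(pauli a * X).trace‖ ^ 2 : ℂ) = 2 ^ n * ‖X‖ ^ 2 := by
    simp only [hterm]
    rw [← Matrix.trace_sum, ← Finset.mul_sum, sum_trace_pauli_mul_smul_pauli, Matrix.mul_smul,
      Matrix.trace_smul, ← frobenius_norm_sq_eq_trace, smul_eq_mul]
  exact_mod_cast hsum

end Pauli

/-! ### The hybrid argument -/

section Ampliate

open scoped Matrix.Norms.Frobenius

variable {I A ι : Type}

lemma ampliate_sub (Φ Ψ : Matrix I I ℂ →ₗ[ℂ] Matrix I I ℂ) (X : Matrix (I × A) (I × A) ℂ) :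
    ampliate A (Φ - Ψ) X = ampliate A Φ X - ampliate A Ψ X := rfl

lemma sum_norm_sq_ampliate_le [Fintype I] [Fintype A] [Fintype ι]
    {Φ : ι → Matrix I I ℂ →ₗ[ℂ] Matrix I I ℂ} {C : ℝ}
    (hΦ : ∀ X, ∑ a, ‖Φ a X‖ ^ 2 ≤ C * ‖X‖ ^ 2) (X : Matrix (I × A) (I × A) ℂ) :
    ∑ a, ‖ampliate A (Φ a) X‖ ^ 2 ≤ C * ‖X‖ ^ 2 :=
  calc ∑ a, ‖ampliate A (Φ a) X‖ ^ 2
      = ∑ u, ∑ v, ∑ a, ‖Φ a (X.submatrix (·, u) (·, v))‖ ^ 2 := by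
        simp only [frobenius_norm_sq_eq_sum_submatrix (ampliate A _ X)]
        rw [Finset.sum_comm]
        exact Finset.sum_congr rfl fun u _ => Finset.sum_comm
    _ ≤ ∑ u, ∑ v, C * ‖X.submatrix (·, u) (·, v)‖ ^ 2 := by gcongr; exact hΦ _
    _ = C * ‖X‖ ^ 2 := by
        simp only [← Finset.mul_sum, frobenius_norm_sq_eq_sum_submatrix X]

end Ampliate

section POVM

variable {I : Type} [Fintype I] [DecidableEq I] {r : ℕ} (M : POVM I r)

lemma POVM.sum_trace_re (X : Matrix I I ℂ) : ∑ j, (M.effect j * X).trace.re = X.trace.re := by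
  rw [← Complex.re_sum, ← Matrix.trace_sum, ← Matrix.sum_mul, M.sum_eq_one, one_mul]

lemma POVM.posSemidef_sum_smul {v : Fin r → ℝ} (hv : ∀ j, 0 ≤ v j) :
    (∑ j, (v j : ℂ) • M.effect j).PosSemidef :=
  Matrix.posSemidef_sum _ fun j _ => (M.posSemidef j).smul (by exact_mod_cast hv j)

lemma POVM.abs_sum_trace_re_mul_le {v : Fin r → ℝ} (hv : ∀ j, v j ∈ Set.Icc 0 1)
    {X : Matrix I I ℂ} {τ : ℝ} (hX : TraceNormLE X τ) :
    |∑ j, (M.effect j * X).trace.re * v j| ≤ τ := by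
  have hcompl : 1 - ∑ j, (v j : ℂ) • M.effect j = ∑ j, ((1 - v j : ℝ) : ℂ) • M.effect j := by
    simp only [Complex.ofReal_sub, Complex.ofReal_one, sub_smul, one_smul,
      Finset.sum_sub_distrib, M.sum_eq_one]
  have hsum : ((∑ j, (v j : ℂ) • M.effect j) * X).trace.re =
      ∑ j, (M.effect j * X).trace.re * v j := by
    simp [Matrix.sum_mul, Matrix.trace_sum, mul_comm]
  rw [← hsum]
  exact hX.abs_trace_mul_le (M.posSemidef_sum_smul fun j => (hv j).1)
    (hcompl ▸ M.posSemidef_sum_smul fun j => sub_nonneg.2 (hv j).2)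

end POVM

section Hybrid

variable {n k : ℕ} {O ι : Type} [Fintype ι]
  {Λ Λ₀ : Matrix (Qubits n) (Qubits n) ℂ →ₗ[ℂ] Matrix (Qubits n) (Qubits n) ℂ}
  {Φ : ι → Matrix (Qubits n) (Qubits n) ℂ →ₗ[ℂ] Matrix (Qubits n) (Qubits n) ℂ} {C K : ℝ}

lemma QuantumChannel.isPositiveTP {I : Type} [Fintype I] (C : QuantumChannel I) :
    IsPositiveTP C.map where
  posSemidef X hX :=
    (C.completelyPositive 1 (X.submatrix Prod.fst Prod.fst) (hX.submatrix _)).submatrix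
      fun i : I => (i, (0 : Fin 1))
  trace_map := C.tracePreserving

lemma posSemidef_evolve (hΛ : IsPositiveTP (ampliate (Qubits k) Λ)) (ρ : DensityMatrix (Sys n k))
    (cs : List (QuantumChannel (Sys n k))) : (evolve Λ ρ cs).PosSemidef := by
  rw [evolve]
  induction cs using List.reverseRecOn with
  | nil => exact ρ.posSemidef
  | append_singleton cs C ih =>
    rw [List.foldl_append]
    exact C.isPositiveTP.posSemidef _ (hΛ.posSemidef _ ih)

lemma trace_evolve (hΛ : IsPositiveTP (ampliate (Qubits k) Λ)) (ρ : DensityMatrix (Sys n k))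
    (cs : List (QuantumChannel (Sys n k))) : (evolve Λ ρ cs).trace = 1 := by
  rw [evolve]
  induction cs using List.reverseRecOn with
  | nil => exact ρ.trace_eq_one
  | append_singleton cs C ih =>
    rw [List.foldl_append]
    exact (C.isPositiveTP.trace_map _).trans ((hΛ.trace_map _).trans ih)

lemma outcome_prob_nonneg (hΛ : IsPositiveTP (ampliate (Qubits k) Λ))
    (ρ : DensityMatrix (Sys n k)) (cs : List (QuantumChannel (Sys n k))) {r : ℕ}
    (M : POVM (Sys n k) r) (j : Fin r) : 0 ≤ (M.effect j * evolve Λ ρ cs).trace.re :=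
  trace_mul_re_nonneg (M.posSemidef j) (posSemidef_evolve hΛ ρ cs)

lemma sum_outcome_prob (hΛ : IsPositiveTP (ampliate (Qubits k) Λ))
    (ρ : DensityMatrix (Sys n k)) (cs : List (QuantumChannel (Sys n k))) {r : ℕ}
    (M : POVM (Sys n k) r) : ∑ j, (M.effect j * evolve Λ ρ cs).trace.re = 1 := by
  rw [M.sum_trace_re, trace_evolve hΛ, Complex.one_re]

lemma Protocol.prob_nonneg (hΛ : IsPositiveTP (ampliate (Qubits k) Λ)) (S : Set O)
    (𝒜 : Protocol n k O) : 0 ≤ 𝒜.prob Λ S := by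
  induction 𝒜 with
  | output o => exact Set.indicator_nonneg (fun _ _ => zero_le_one) _
  | round ρ cs r M next ih =>
    exact Finset.sum_nonneg fun j _ => mul_nonneg (outcome_prob_nonneg hΛ ρ cs M j) (ih j)

lemma Protocol.prob_mono (hΛ : IsPositiveTP (ampliate (Qubits k) Λ)) {S T : Set O} (h : S ⊆ T)
    (𝒜 : Protocol n k O) : 𝒜.prob Λ S ≤ 𝒜.prob Λ T := by
  induction 𝒜 with
  | output o => exact Set.indicator_le_indicator_of_subset h (fun _ => zero_le_one) o
  | round ρ cs r M next ih =>
    exact Finset.sum_le_sum fun j _ =>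
      mul_le_mul_of_nonneg_left (ih j) (outcome_prob_nonneg hΛ ρ cs M j)

lemma Protocol.prob_add_prob_compl (hΛ : IsPositiveTP (ampliate (Qubits k) Λ)) (S : Set O)
    (𝒜 : Protocol n k O) : 𝒜.prob Λ S + 𝒜.prob Λ Sᶜ = 1 := by
  induction 𝒜 with
  | output o => by_cases h : o ∈ S <;> simp [prob, h]
  | round ρ cs r M next ih =>
    simp only [prob, ← Finset.sum_add_distrib, ← mul_add, ih, mul_one, sum_outcome_prob hΛ]

lemma Protocol.prob_mem_Icc (hΛ : IsPositiveTP (ampliate (Qubits k) Λ)) (S : Set O)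
    (𝒜 : Protocol n k O) : 𝒜.prob Λ S ∈ Set.Icc 0 1 :=
  ⟨𝒜.prob_nonneg hΛ S, by linarith [𝒜.prob_add_prob_compl hΛ S, 𝒜.prob_nonneg hΛ Sᶜ]⟩

/-- On every state of the working qubits and `k` ancilla qubits, the trace norms of the
differences between one use of `Φ a` and one of `Λ₀` add up over `a` to at most `K`. -/
def TotalDeviationLE (k : ℕ)
    (Φ : ι → Matrix (Qubits n) (Qubits n) ℂ →ₗ[ℂ] Matrix (Qubits n) (Qubits n) ℂ)
    (Λ₀ : Matrix (Qubits n) (Qubits n) ℂ →ₗ[ℂ] Matrix (Qubits n) (Qubits n) ℂ) (K : ℝ) : Prop :=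
  ∀ σ : DensityMatrix (Sys n k), ∃ τ : ι → ℝ,
    (∀ a, TraceNormLE (ampliate (Qubits k) (Φ a - Λ₀) σ.mat) (τ a)) ∧ ∑ a, τ a ≤ K

lemma exists_traceNormLE_evolve_sub (hΦ : ∀ a, IsPositiveTP (ampliate (Qubits k) (Φ a)))
    (h₀ : IsPositiveTP (ampliate (Qubits k) Λ₀)) (hK : TotalDeviationLE k Φ Λ₀ K)
    (ρ : DensityMatrix (Sys n k)) (cs : List (QuantumChannel (Sys n k))) :
    ∃ τ : ι → ℝ, (∀ a, TraceNormLE (evolve (Φ a) ρ cs - evolve Λ₀ ρ cs) (τ a)) ∧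
      ∑ a, τ a ≤ cs.length * K := by
  induction cs using List.reverseRecOn with
  | nil => exact ⟨0, fun a => by simpa [evolve] using traceNormLE_zero, by simp⟩
  | append_singleton cs C ih =>
    obtain ⟨τ, hτ, hτK⟩ := ih
    obtain ⟨σ, hσ, hσK⟩ := hK ⟨_, posSemidef_evolve h₀ ρ cs, trace_evolve h₀ ρ cs⟩
    refine ⟨fun a => τ a + σ a, fun a => ?_, ?_⟩
    · have h := (((hτ a).map (hΦ a)).add (hσ a)).map C.isPositiveTP
      simp only [ampliate_sub, map_sub, sub_add_sub_cancel] at h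
      simpa [evolve] using h
    · rw [Finset.sum_add_distrib, List.length_append, List.length_singleton]
      push_cast
      linarith

namespace Protocol

variable (ρ : DensityMatrix (Sys n k)) (cs : List (QuantumChannel (Sys n k))) {r : ℕ}
  (M : POVM (Sys n k) r) (next : Fin r → Protocol n k O)

lemma prob_round_sub (S : Set O) :
    (round ρ cs r M next).prob Λ S - (round ρ cs r M next).prob Λ₀ S =
      ∑ j, (M.effect j * (evolve Λ ρ cs - evolve Λ₀ ρ cs)).trace.re * (next j).prob Λ S +
        ∑ j, (M.effect j * evolve Λ₀ ρ cs).trace.re *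
          ((next j).prob Λ S - (next j).prob Λ₀ S) := by
  simp only [prob, ← Finset.sum_sub_distrib, ← Finset.sum_add_distrib, Matrix.mul_sub,
    Matrix.trace_sub, Complex.sub_re]
  exact Finset.sum_congr rfl fun j _ => by ring

lemma abs_prob_round_sub_le (hΛ : IsPositiveTP (ampliate (Qubits k) Λ))
    (h₀ : IsPositiveTP (ampliate (Qubits k) Λ₀)) {τ : ℝ}
    (hτ : TraceNormLE (evolve Λ ρ cs - evolve Λ₀ ρ cs) τ) (S : Set O) :
    |(round ρ cs r M next).prob Λ S - (round ρ cs r M next).prob Λ₀ S| ≤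
      τ + ∑ j, (M.effect j * evolve Λ₀ ρ cs).trace.re *
        |(next j).prob Λ S - (next j).prob Λ₀ S| := by
  rw [prob_round_sub]
  refine (abs_add_le _ _).trans (add_le_add
    (M.abs_sum_trace_re_mul_le (fun j => (next j).prob_mem_Icc hΛ S) hτ) ?_)
  refine (Finset.abs_sum_le_sum_abs _ _).trans_eq (Finset.sum_congr rfl fun j _ => ?_)
  rw [abs_mul, abs_of_nonneg (outcome_prob_nonneg h₀ ρ cs M j)]

lemma sum_abs_prob_sub_le (hΦ : ∀ a, IsPositiveTP (ampliate (Qubits k) (Φ a)))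
    (h₀ : IsPositiveTP (ampliate (Qubits k) Λ₀)) (hK₀ : 0 ≤ K) (hK : TotalDeviationLE k Φ Λ₀ K)
    (S : ι → Set O) (𝒜 : Protocol n k O) :
    ∑ a, |𝒜.prob (Φ a) (S a) - 𝒜.prob Λ₀ (S a)| ≤ 𝒜.queries * K := by
  induction 𝒜 with
  | output o => simp [prob, queries]
  | round ρ cs r M next ih =>
    obtain ⟨τ, hτ, hτK⟩ := exists_traceNormLE_evolve_sub hΦ h₀ hK ρ cs
    let w (j : Fin r) : ℝ := (M.effect j * evolve Λ₀ ρ cs).trace.re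
    let Q : ℕ := Finset.univ.sup fun j => (next j).queries
    have hw (j : Fin r) : 0 ≤ w j := outcome_prob_nonneg h₀ ρ cs M j
    have hQ (j : Fin r) : (next j).queries ≤ Q :=
      Finset.le_sup (f := fun j => (next j).queries) (Finset.mem_univ j)
    calc _ ≤ ∑ a, (τ a + ∑ j, w j * |(next j).prob (Φ a) (S a) - (next j).prob Λ₀ (S a)|) :=
          Finset.sum_le_sum fun a _ => abs_prob_round_sub_le ρ cs M next (hΦ a) h₀ (hτ a) (S a)
      _ = ∑ a, τ a + ∑ j, w j * ∑ a, |(next j).prob (Φ a) (S a) - (next j).prob Λ₀ (S a)| := by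
          rw [Finset.sum_add_distrib, Finset.sum_comm]
          simp only [Finset.mul_sum]
      _ ≤ cs.length * K + ∑ j, w j * (Q * K) := by
          gcongr with j
          · exact hw j
          · refine (ih j).trans ?_
            gcongr
            exact hQ j
      _ = (cs.length + Q : ℕ) * K := by
          rw [← Finset.sum_mul, sum_outcome_prob h₀, Nat.cast_add]
          ring

end Protocol

open scoped Matrix.Norms.Frobenius in
/-- Cauchy-Schwarz turns trace norms into Hilbert-Schmidt norms, and the Hilbert-Schmidt norm of a
state is at most `1`. -/
lemma totalDeviationLE_of_sum_norm_sq_le (hΦ : ∀ a, IsPositiveTP (ampliate (Qubits k) (Φ a)))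
    (h₀ : IsPositiveTP (ampliate (Qubits k) Λ₀)) (hC₀ : 0 ≤ C)
    (hC : ∀ X, ∑ a, ‖(Φ a - Λ₀) X‖ ^ 2 ≤ C * ‖X‖ ^ 2) :
    TotalDeviationLE k Φ Λ₀ √(Fintype.card ι * 2 ^ (n + k) * C) := by
  intro σ
  let D (a : ι) : Matrix (Sys n k) (Sys n k) ℂ := ampliate (Qubits k) (Φ a - Λ₀) σ.mat
  have hD (a : ι) : (D a).IsHermitian :=
    ((hΦ a).posSemidef _ σ.posSemidef).isHermitian.sub (h₀.posSemidef _ σ.posSemidef).isHermitian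
  have hcard : (Fintype.card (Sys n k) : ℝ) = 2 ^ (n + k) := by simp [pow_add]
  have hpurity : ‖σ.mat‖ ≤ 1 := by
    simpa [σ.trace_eq_one] using frobenius_norm_le_trace σ.posSemidef
  refine ⟨fun a => √(Fintype.card (Sys n k)) * ‖D a‖, fun a => traceNormLE_of_isHermitian (hD a),
    Real.le_sqrt_of_sq_le ?_⟩
  calc (∑ a, √(Fintype.card (Sys n k)) * ‖D a‖) ^ 2
      ≤ Fintype.card ι * ∑ a, (√(Fintype.card (Sys n k)) * ‖D a‖) ^ 2 := sq_sum_le_card_mul_sum_sq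
    _ = Fintype.card ι * 2 ^ (n + k) * ∑ a, ‖D a‖ ^ 2 := by
        simp only [mul_pow, ← Finset.mul_sum, Real.sq_sqrt (Nat.cast_nonneg _)]
        rw [hcard, mul_assoc]
    _ ≤ Fintype.card ι * 2 ^ (n + k) * (C * ‖σ.mat‖ ^ 2) := by
        gcongr
        exact sum_norm_sq_ampliate_le hC σ.mat
    _ ≤ Fintype.card ι * 2 ^ (n + k) * C := by
        gcongr
        exact mul_le_of_le_one_right hC₀ (pow_le_one₀ (norm_nonneg _) hpurity)

end Hybrid

/-! ### Spiked Pauli channels -/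

section PauliChannel

open scoped Kronecker Matrix.Norms.Frobenius

variable {n k : ℕ}

lemma pauliChannel_apply (p : PauliIndex n → ℝ) (X : Matrix (Qubits n) (Qubits n) ℂ) :
    pauliChannel p X = ∑ a, (p a : ℂ) • (pauli a * X * pauli a) := by
  simp [pauliChannel, LinearMap.sum_apply]

lemma ampliate_pauliChannel_apply (p : PauliIndex n → ℝ) (X : Matrix (Sys n k) (Sys n k) ℂ) :
    ampliate (Qubits k) (pauliChannel p) X = ∑ a, (p a : ℂ) •
      ((pauli a ⊗ₖ (1 : Matrix (Qubits k) (Qubits k) ℂ)) * X *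
        (pauli a ⊗ₖ (1 : Matrix (Qubits k) (Qubits k) ℂ))) := by
  ext ⟨s, u⟩ ⟨t, v⟩
  simp [ampliate, pauliChannel_apply, Matrix.sum_apply, Matrix.mul_apply, Fintype.sum_prod_type,
    Matrix.one_apply]

lemma isPositiveTP_pauliChannel {p : PauliIndex n → ℝ} (hp : p ∈ stdSimplex ℝ (PauliIndex n)) :
    IsPositiveTP (ampliate (Qubits k) (pauliChannel p)) where
  posSemidef X hX := by
    rw [ampliate_pauliChannel_apply]
    refine Matrix.posSemidef_sum _ fun a _ => Matrix.PosSemidef.smul ?_ (by exact_mod_cast hp.1 a)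
    have h := hX.mul_mul_conjTranspose_same (pauli a ⊗ₖ (1 : Matrix (Qubits k) (Qubits k) ℂ))
    rwa [Matrix.conjTranspose_kronecker, (pauli_isHermitian a).eq, Matrix.conjTranspose_one] at h
  trace_map X := by
    have h (a : PauliIndex n) : ((pauli a ⊗ₖ (1 : Matrix (Qubits k) (Qubits k) ℂ)) * X *
        (pauli a ⊗ₖ (1 : Matrix (Qubits k) (Qubits k) ℂ))).trace = X.trace := by
      rw [Matrix.trace_mul_comm, ← mul_assoc, ← Matrix.mul_kronecker_mul, pauli_mul_self, one_mul,
        Matrix.one_kronecker_one, one_mul]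
    rw [ampliate_pauliChannel_apply, Matrix.trace_sum]
    simp only [Matrix.trace_smul, h, ← Finset.sum_smul]
    rw [← Complex.ofReal_sum, hp.2, Complex.ofReal_one, one_smul]

lemma card_pauliIndex : Fintype.card (PauliIndex n) = 4 ^ n := by
  simp

lemma depolarizing_eq_pauliChannel : depolarizing n = pauliChannel fun _ => (4 ^ n)⁻¹ := by
  ext1 X
  have h4 : (4 : ℂ) ^ n = 2 ^ n * 2 ^ n := by rw [← mul_pow]; norm_num
  simp only [depolarizing, pauliChannel_apply, ← Finset.smul_sum, sum_pauli_mul_mul_pauli]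
  simp [h4, smul_smul, mul_assoc]

lemma isPositiveTP_depolarizing : IsPositiveTP (ampliate (Qubits k) (depolarizing n)) := by
  rw [depolarizing_eq_pauliChannel]
  refine isPositiveTP_pauliChannel ⟨fun _ => by positivity, ?_⟩
  simp [Finset.card_univ]

/-- The error rates of the Pauli channel whose Pauli eigenvalue at `a` is `c` and whose other Pauli
eigenvalues, except at `0`, vanish: the inverse Fourier transform of this spectrum. -/
noncomputable def spikeRates (a : PauliIndex n) (c : ℝ) (b : PauliIndex n) : ℝ :=
  (4 ^ n)⁻¹ * (1 + c * (-1) ^ (symplectic a b).val)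

lemma spikeRates_mem_stdSimplex {a : PauliIndex n} (ha : a ≠ 0) {c : ℝ} (hc : |c| ≤ 1) :
    spikeRates a c ∈ stdSimplex ℝ (PauliIndex n) := by
  refine ⟨fun b => mul_nonneg (by positivity) ?_, ?_⟩
  · have h : |c * (-1) ^ (symplectic a b).val| ≤ 1 := by simpa [abs_mul] using hc
    linarith [(abs_le.1 h).1]
  · simp only [spikeRates, ← Finset.mul_sum, Finset.sum_add_distrib, sum_neg_one_pow_symplectic ha]
    simp [Finset.card_univ]

lemma pauliEigenvalue_spikeRates {a : PauliIndex n} (ha : a ≠ 0) (c : ℝ) :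
    pauliEigenvalue (spikeRates a c) a = c := by
  have h (b : PauliIndex n) : spikeRates a c b * (-1) ^ (symplectic b a).val =
      (4 ^ n)⁻¹ * ((-1) ^ (symplectic a b).val + c) := by
    rw [spikeRates, symplectic_comm b a, mul_assoc, add_mul, one_mul, mul_assoc, ← mul_pow]
    simp
  simp only [pauliEigenvalue, h, ← Finset.mul_sum, Finset.sum_add_distrib,
    sum_neg_one_pow_symplectic ha]
  simp [Finset.card_univ]

lemma pauliChannel_spikeRates_sub_depolarizing_apply (a : PauliIndex n) (c : ℝ)
    (X : Matrix (Qubits n) (Qubits n) ℂ) :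
    (pauliChannel (spikeRates a c) - depolarizing n) X =
      (c * ((2 : ℂ) ^ n)⁻¹ * (pauli a * X).trace) • pauli a := by
  have h4 : (4 : ℂ) ^ n = 2 ^ n * 2 ^ n := by rw [← mul_pow]; norm_num
  have hrate (b : PauliIndex n) : (spikeRates a c b : ℂ) • (pauli b * X * pauli b) =
      (((4 ^ n)⁻¹ : ℝ) : ℂ) • (pauli b * X * pauli b) + (c * ((4 : ℂ) ^ n)⁻¹) •
        (-1 : ℂ) ^ (symplectic a b).val • (pauli b * X * pauli b) := by
    rw [smul_smul, ← add_smul, spikeRates]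
    push_cast
    ring_nf
  rw [LinearMap.sub_apply, depolarizing_eq_pauliChannel, pauliChannel_apply, pauliChannel_apply,
    Finset.sum_congr rfl fun b _ => hrate b, Finset.sum_add_distrib, add_sub_cancel_left,
    ← Finset.smul_sum, sum_neg_one_pow_smul_pauli_mul_mul_pauli, smul_smul, h4]
  congr 1
  field_simp

lemma spiked_eq_pauliChannel (a : PauliIndex n) : spiked a = pauliChannel (spikeRates a 1) := by
  ext1 X
  rw [← sub_add_cancel (pauliChannel (spikeRates a 1)) (depolarizing n), LinearMap.add_apply,
    pauliChannel_spikeRates_sub_depolarizing_apply]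
  simp [spiked, depolarizing, smul_smul, add_comm]

lemma sum_norm_sq_pauliChannel_spikeRates_sub_depolarizing (c : ℝ)
    (X : Matrix (Qubits n) (Qubits n) ℂ) :
    ∑ a : PauliIndex n, ‖(pauliChannel (spikeRates a c) - depolarizing n) X‖ ^ 2 =
      c ^ 2 * ‖X‖ ^ 2 := by
  have hterm (a : PauliIndex n) :
      ‖(pauliChannel (spikeRates a c) - depolarizing n) X‖ ^ 2 =
        c ^ 2 * (2 ^ n)⁻¹ * ‖(pauli a * X).trace‖ ^ 2 := by
    rw [pauliChannel_spikeRates_sub_depolarizing_apply, norm_smul, mul_pow,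
      frobenius_norm_sq_pauli]
    simp only [norm_mul, norm_inv, norm_pow, Complex.norm_real, Real.norm_eq_abs, mul_pow, sq_abs,
      Complex.norm_ofNat]
    field_simp
  simp only [hterm, ← Finset.mul_sum, sum_norm_sq_trace_pauli_mul]
  field_simp

lemma card_ne_zero_pauliIndex :
    (Fintype.card {a : PauliIndex n // a ≠ 0} : ℝ) = 4 ^ n - 1 := by
  rw [Fintype.card_subtype_compl, Fintype.card_subtype_eq, card_pauliIndex,
    Nat.cast_sub (Nat.one_le_pow _ _ (by norm_num))]
  norm_cast

lemma sum_abs_prob_spike_sub_le {O : Type} {c : ℝ} (hc : |c| ≤ 1)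
    (S : {a : PauliIndex n // a ≠ 0} → Set O) (𝒜 : Protocol n k O) :
    ∑ a, |𝒜.prob (pauliChannel (spikeRates a.1 c)) (S a) - 𝒜.prob (depolarizing n) (S a)| ≤
      𝒜.queries * √((4 ^ n - 1) * 2 ^ (n + k)) := by
  have hΦ (a : {a : PauliIndex n // a ≠ 0}) :
      IsPositiveTP (ampliate (Qubits k) (pauliChannel (spikeRates a.1 c))) :=
    isPositiveTP_pauliChannel (spikeRates_mem_stdSimplex a.2 hc)
  have hsum (X : Matrix (Qubits n) (Qubits n) ℂ) : ∑ a : {a : PauliIndex n // a ≠ 0},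
      ‖(pauliChannel (spikeRates a.1 c) - depolarizing n) X‖ ^ 2 ≤ 1 * ‖X‖ ^ 2 := by
    calc _ ≤ ∑ a : PauliIndex n, ‖(pauliChannel (spikeRates a c) - depolarizing n) X‖ ^ 2 := by
          rw [← Fintype.sum_subtype_add_sum_subtype fun a : PauliIndex n => a ≠ 0]
          exact le_add_of_nonneg_right (by positivity)
      _ ≤ 1 * ‖X‖ ^ 2 := by
          rw [sum_norm_sq_pauliChannel_spikeRates_sub_depolarizing]
          gcongr
          exact (sq_le_one_iff_abs_le_one c).2 hc
  have hdev := totalDeviationLE_of_sum_norm_sq_le hΦ isPositiveTP_depolarizing zero_le_one hsum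
  rw [card_ne_zero_pauliIndex, mul_one] at hdev
  exact 𝒜.sum_abs_prob_sub_le hΦ isPositiveTP_depolarizing (Real.sqrt_nonneg _) hdev S

end PauliChannel

/-! ### Query lower bounds -/

section LowerBound

variable {n k : ℕ} {O : Type}

lemma Protocol.advantage_le
    {Λ₀ Λ₁ Λ₂ : Matrix (Qubits n) (Qubits n) ℂ →ₗ[ℂ] Matrix (Qubits n) (Qubits n) ℂ}
    (h₀ : IsPositiveTP (ampliate (Qubits k) Λ₀)) (𝒜 : Protocol n k O) {S : Set O} {δ : ℝ}
    (h₁ : δ ≤ 𝒜.prob Λ₁ S) (h₂ : δ ≤ 𝒜.prob Λ₂ Sᶜ) :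
    2 * δ - 1 ≤ |𝒜.prob Λ₁ S - 𝒜.prob Λ₀ S| + |𝒜.prob Λ₂ Sᶜ - 𝒜.prob Λ₀ Sᶜ| := by
  linarith [𝒜.prob_add_prob_compl h₀ S, le_abs_self (𝒜.prob Λ₁ S - 𝒜.prob Λ₀ S),
    le_abs_self (𝒜.prob Λ₂ Sᶜ - 𝒜.prob Λ₀ Sᶜ)]

lemma SolvesEigenvalueEstimation.le_prob_pos {𝒜 : Protocol n k (PauliIndex n → ℝ)} {ε δ : ℝ}
    (h : SolvesEigenvalueEstimation 𝒜 ε δ) (hε : ε ≤ 1) {a : PauliIndex n} (ha : a ≠ 0) :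
    δ ≤ 𝒜.prob (pauliChannel (spikeRates a 1)) {est | 0 < est a} := by
  have hmem := spikeRates_mem_stdSimplex ha (c := 1) (by simp)
  refine (h _ hmem).trans (𝒜.prob_mono (isPositiveTP_pauliChannel hmem) fun est hest => ?_)
  have hest_a := (abs_lt.1 (hest a)).1
  rw [pauliEigenvalue_spikeRates ha] at hest_a
  exact Set.mem_ofPred.2 (by linarith)

lemma SolvesEigenvalueEstimation.le_prob_compl_pos {𝒜 : Protocol n k (PauliIndex n → ℝ)}
    {ε δ : ℝ} (h : SolvesEigenvalueEstimation 𝒜 ε δ) (hε : ε ≤ 1) {a : PauliIndex n}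
    (ha : a ≠ 0) : δ ≤ 𝒜.prob (pauliChannel (spikeRates a (-1))) {est | 0 < est a}ᶜ := by
  have hmem := spikeRates_mem_stdSimplex ha (c := -1) (by simp)
  refine (h _ hmem).trans (𝒜.prob_mono (isPositiveTP_pauliChannel hmem) fun est hest => ?_)
  have hest_a := (abs_lt.1 (hest a)).2
  rw [pauliEigenvalue_spikeRates ha] at hest_a
  exact Set.notMem_ofPred_iff.2 (by linarith)

lemma SolvesEigenvalueEstimation.le_queries_mul_sqrt {𝒜 : Protocol n k (PauliIndex n → ℝ)}
    {ε δ : ℝ} (h : SolvesEigenvalueEstimation 𝒜 ε δ) (hε : ε ≤ 1) :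
    (2 * δ - 1) * (4 ^ n - 1) ≤ 2 * (𝒜.queries * √((4 ^ n - 1) * 2 ^ (n + k))) := by
  let S (a : {a : PauliIndex n // a ≠ 0}) : Set (PauliIndex n → ℝ) := {est | 0 < est a.1}
  calc (2 * δ - 1) * (4 ^ n - 1) = ∑ _a : {a : PauliIndex n // a ≠ 0}, (2 * δ - 1) := by
        rw [Finset.sum_const, Finset.card_univ, nsmul_eq_mul, card_ne_zero_pauliIndex, mul_comm]
    _ ≤ ∑ a : {a : PauliIndex n // a ≠ 0},
        (|𝒜.prob (pauliChannel (spikeRates a.1 1)) (S a) - 𝒜.prob (depolarizing n) (S a)| +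
          |𝒜.prob (pauliChannel (spikeRates a.1 (-1))) (S a)ᶜ -
            𝒜.prob (depolarizing n) (S a)ᶜ|) :=
        Finset.sum_le_sum fun a _ => 𝒜.advantage_le isPositiveTP_depolarizing
          (h.le_prob_pos hε a.2) (h.le_prob_compl_pos hε a.2)
    _ ≤ 2 * (𝒜.queries * √((4 ^ n - 1) * 2 ^ (n + k))) := by
        rw [Finset.sum_add_distrib, two_mul]
        exact add_le_add (sum_abs_prob_spike_sub_le (by simp) S 𝒜)
          (sum_abs_prob_spike_sub_le (by simp) (fun a => (S a)ᶜ) 𝒜)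

lemma SolvesSpikeDetection.le_queries_mul_sqrt {𝒜 : Protocol n k Bool} {δ : ℝ}
    (h : SolvesSpikeDetection 𝒜 δ) (hn : 1 ≤ n) :
    (2 * δ - 1) * (4 ^ n - 1) ≤ 𝒜.queries * √((4 ^ n - 1) * 2 ^ (n + k)) := by
  have hpos : (0 : ℝ) < 4 ^ n - 1 := sub_pos.2 (one_lt_pow₀ (by norm_num) (by lia))
  have hfalse : 𝒜.prob (depolarizing n) {false} = 1 - 𝒜.prob (depolarizing n) {true} := by
    rw [← 𝒜.prob_add_prob_compl isPositiveTP_depolarizing {true}, add_sub_cancel_left,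
      Bool.compl_singleton, Bool.not_true]
  rw [SolvesSpikeDetection, hfalse] at h
  have hsuccess : (2 * δ - 1 + 𝒜.prob (depolarizing n) {true}) * (4 ^ n - 1) ≤
      ∑ a : {a : PauliIndex n // a ≠ 0}, 𝒜.prob (spiked a.1) {true} := by
    rw [← le_div_iff₀ hpos]
    linarith
  calc (2 * δ - 1) * (4 ^ n - 1)
      ≤ ∑ a : {a : PauliIndex n // a ≠ 0},
          (𝒜.prob (spiked a.1) {true} - 𝒜.prob (depolarizing n) {true}) := by
        rw [Finset.sum_sub_distrib, Finset.sum_const, Finset.card_univ, nsmul_eq_mul,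
          card_ne_zero_pauliIndex]
        linarith
    _ ≤ ∑ a : {a : PauliIndex n // a ≠ 0},
          |𝒜.prob (pauliChannel (spikeRates a.1 1)) {true} - 𝒜.prob (depolarizing n) {true}| := by
        simp only [spiked_eq_pauliChannel]
        exact Finset.sum_le_sum fun a _ => le_abs_self _
    _ ≤ 𝒜.queries * √((4 ^ n - 1) * 2 ^ (n + k)) :=
        sum_abs_prob_spike_sub_le (by simp) (fun _ => {true}) 𝒜

lemma mul_two_rpow_le_of_le_mul_sqrt (hn : 1 ≤ n) {c x : ℝ} (hc : 0 ≤ c)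
    (h : c * (4 ^ n - 1) ≤ x * √((4 ^ n - 1) * 2 ^ (n + k))) :
    c * (2 : ℝ) ^ (((n : ℝ) - k) / 2) ≤ 2 * x := by
  have h4 : (4 : ℝ) ≤ 4 ^ n := le_self_pow₀ (by norm_num) (by lia)
  have hD : 0 < √((4 : ℝ) ^ n - 1) := Real.sqrt_pos.2 (by linarith)
  have hcancel : c * √(4 ^ n - 1) ≤ x * √(2 ^ (n + k)) := by
    rw [Real.sqrt_mul (by linarith), mul_left_comm, mul_comm] at h
    refine le_of_mul_le_mul_left (h.trans' (le_of_eq ?_)) hD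
    rw [mul_left_comm, Real.mul_self_sqrt (by linarith), mul_comm]
  have hsqrt : 2 ^ n ≤ 2 * √((4 : ℝ) ^ n - 1) := by
    refine le_of_sq_le_sq ?_ (by positivity)
    rw [mul_pow, Real.sq_sqrt (by linarith), ← pow_mul, mul_comm n, pow_mul]
    norm_num
    linarith
  have hdim : (2 : ℝ) ^ (((n : ℝ) - k) / 2) * √(2 ^ (n + k)) = 2 ^ n := by
    rw [Real.sqrt_eq_rpow, ← Real.rpow_natCast, ← Real.rpow_mul two_pos.le,
      ← Real.rpow_add two_pos, ← Real.rpow_natCast]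
    push_cast
    ring_nf
  refine le_of_mul_le_mul_right ?_ (show 0 < √((2 : ℝ) ^ (n + k)) by positivity)
  calc c * (2 : ℝ) ^ (((n : ℝ) - k) / 2) * √(2 ^ (n + k)) = c * 2 ^ n := by rw [mul_assoc, hdim]
    _ ≤ c * (2 * √(4 ^ n - 1)) := by gcongr
    _ ≤ 2 * x * √(2 ^ (n + k)) := by linarith

lemma min_mul_two_rpow_le_of_mul_two_rpow_le {c x : ℝ} {q : ℕ} (hc : 0 < c)
    (h : c * (2 : ℝ) ^ (x / 2) ≤ q) : min c 1 * (2 : ℝ) ^ (x / 3) ≤ q := by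
  have hq : (1 : ℝ) ≤ q := by
    have : (0 : ℝ) < q := lt_of_lt_of_le (by positivity) h
    exact_mod_cast this
  rcases le_total x 0 with hx | hx
  · refine (mul_le_one₀ (min_le_right _ _) (by positivity) ?_).trans hq
    exact Real.rpow_le_one_of_one_le_of_nonpos one_le_two (by linarith)
  · refine le_trans ?_ h
    gcongr ?_ * 2 ^ ?_
    · exact min_le_left _ _
    · norm_num
    · linarith

end LowerBound

end PauliLearning

theorem theorem4p1_general (δ : ℝ) (hδ : 1 / 2 ≤ δ) (n k : ℕ) (hn : 1 ≤ n) :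
    (∀ ε ≤ 1, ∀ 𝒜 : Protocol n k (PauliIndex n → ℝ), SolvesEigenvalueEstimation 𝒜 ε δ →
      (2 * δ - 1) / 4 * (2 : ℝ) ^ (((n : ℝ) - k) / 2) ≤ 𝒜.queries) ∧
    (∀ 𝒜 : Protocol n k Bool, SolvesSpikeDetection 𝒜 δ →
      (2 * δ - 1) / 4 * (2 : ℝ) ^ (((n : ℝ) - k) / 2) ≤ 𝒜.queries) := by
  refine ⟨fun ε hε 𝒜 h => ?_, fun 𝒜 h => ?_⟩
  · have hq := h.le_queries_mul_sqrt hε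
    rw [← mul_assoc] at hq
    linarith [mul_two_rpow_le_of_le_mul_sqrt hn (by linarith) hq]
  · have hq := mul_two_rpow_le_of_le_mul_sqrt hn (by linarith) (h.le_queries_mul_sqrt hn)
    linarith [𝒜.queries.cast_nonneg (α := ℝ)]

theorem theorem4p1 (δ : ℝ) (hδ : 1 / 2 < δ) :
    ∃ c : ℝ, 0 < c ∧ ∀ n k : ℕ, 1 ≤ n →
      (∀ ε : ℝ, 0 < ε → ε ≤ 1 → ∀ 𝒜 : Protocol n k (PauliIndex n → ℝ),
        SolvesEigenvalueEstimation 𝒜 ε δ →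
          c * (2 : ℝ) ^ (((n : ℝ) - (k : ℝ)) / 3) ≤ (𝒜.queries : ℝ)) ∧
      (∀ 𝒜 : Protocol n k Bool, SolvesSpikeDetection 𝒜 δ →
        c * (2 : ℝ) ^ (((n : ℝ) - (k : ℝ)) / 3) ≤ (𝒜.queries : ℝ)) := by
  have hc : 0 < (2 * δ - 1) / 4 := by linarith
  refine ⟨min ((2 * δ - 1) / 4) 1, lt_min hc one_pos, fun n k hn => ?_⟩
  obtain ⟨hest, hspike⟩ := theorem4p1_general δ hδ.le n k hn
  exact ⟨fun ε _ hε 𝒜 h => min_mul_two_rpow_le_of_mul_two_rpow_le hc (hest ε hε 𝒜 h),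
    fun 𝒜 h => min_mul_two_rpow_le_of_mul_two_rpow_le hc (hspike 𝒜 h)⟩
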